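/- Let $p>q$ be odd primes with $q\mid p-1$. Let $q^{e_0}$ be the largest power of $q$ dividing $p-1$ and put $s=(p-1)/q^{e_0}$. Let $a_\alpha,a_\beta\in(\mathbb{Z}/p)^\times$ have orders $q^{e_0}$ and $s$ respectively, and put $k=a_\alpha^{q^{e_0-1}}$, an element of order $q$. Let $$N=C_p\rtimes C_q=\langle\sigma,\tau\mid\sigma^p=\tau^q=1,\ \tau\sigma=\sigma^k\tau\rangle$$ be the non-abelian group of order $pq$, and let $\mathrm{Hol}(N)=N\rtimes\mathrm{Aut}(N)$, with multiplication $[\eta,\alpha][\mu,\beta]=[\eta\,\alpha(\mu),\alpha\beta]$. Let $\theta\in\mathrm{Aut}(N)$ be given by $\theta(\sigma)=\sigma$, $\theta(\tau)=\sigma\tau$. In $\mathrm{Hol}(N)$ put $$\mathbf e_1=[\sigma,1],\quad \mathbf e_2=[\sigma,\theta^{k-1}],\quad P=\langle\mathbf e_1,\mathbf e_2\rangle\cong\mathbb{F}_p^2,\quad T=[\tau,1],\quad A=[1,\alpha],\quad B=[1,\beta],$$ where $\alpha,\beta\in\mathrm{Aut}(N)$ fix $\tau$ and satisfy $\alpha(\sigma)=\sigma^{a_\alpha}$,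 $\beta(\sigma)=\sigma^{a_\beta}$. (Thus $T,A,B$ commute, and they act on $P$ by conjugation, in the basis $\mathbf e_1,\mathbf e_2$, as $\mathrm{diag}(k,1)$ and as the scalars $a_\alpha$ and $a_\beta$.) For $1\le c\le e_0$, a divisor $d$ of $s$, and $u\in(\mathbb{Z}/q^c)^\times$, let $$G=P\rtimes\langle TA^{uq^{e_0-c}},\,B^{s/d}\rangle\le\mathrm{Hol}(N).$$ Then the subgroups of index $pq$ in $G$ form exactly one isomorphism class of abstract groups. Under the natural action of $\mathrm{Aut}(G)$ they form exactly $2$ orbits if $c=1$ and $u\equiv(q-1)/2 \pmod q$, and exactly $3$ orbits otherwise. -/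

import Mathlib

/-- The holomorph `Hol(N) = N ⋊ Aut(N)`, with
`[η, α] * [μ, β] = [η * α μ, α * β]`. -/
abbrev Hol (N : Type*) [Group N] : Type _ :=
  N ⋊[MonoidHom.id (MulAut N)] MulAut N

/-- Two subgroups of index `n` of `G` are equivalent if they lie in the same orbit
under the natural action of `Aut(G)`. -/
def autOrbitSetoid (G : Type*) [Group G] (n : ℕ) :
    Setoid {H : Subgroup G // H.index = n} where
  r H₁ H₂ := ∃ φ : G ≃* G, H₁.1.map φ.toMonoidHom = H₂.1
  iseqv :=
    { refl := fun H => ⟨MulEquiv.refl G, Subgroup.map_id H.1⟩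
      symm := by
        rintro H₁ H₂ ⟨φ, h⟩
        refine ⟨φ.symm, ?_⟩
        rw [← h]
        ext x
        simp [Subgroup.mem_map]
      trans := by
        rintro H₁ H₂ H₃ ⟨φ, h⟩ ⟨ψ, h'⟩
        refine ⟨φ.trans ψ, ?_⟩
        rw [← h', ← h]
        ext x
        simp [Subgroup.mem_map] }

/-- Two subgroups of index `n` of `G` are equivalent if they are isomorphic as abstract
groups. -/
def isoSetoid (G : Type*) [Group G] (n : ℕ) :
    Setoid {H : Subgroup G // H.index = n} where
  r H₁ H₂ := Nonempty (H₁.1 ≃* H₂.1)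
  iseqv :=
    { refl := fun _ => ⟨MulEquiv.refl _⟩
      symm := fun ⟨e⟩ => ⟨e.symm⟩
      trans := fun ⟨e⟩ ⟨f⟩ => ⟨e.trans f⟩ }

/-- The number of `Aut(G)`-orbits on the subgroups of index `n` of `G`. -/
noncomputable def numAutOrbits (G : Type*) [Group G] (n : ℕ) : ℕ :=
  Nat.card (Quotient (autOrbitSetoid G n))

/-- The number of abstract isomorphism classes of the subgroups of index `n` of `G`. -/
noncomputable def numIsoClasses (G : Type*) [Group G] (n : ℕ) : ℕ :=
  Nat.card (Quotient (isoSetoid G n))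

namespace Metacyclic

/-- A unit `b` of `ℤ/p` acts on the cyclic group `C_p` (the additive group of `ℤ/p`, written
multiplicatively) by `x ↦ b * x`, that is by raising to the power `b`. -/
def mulAction (p : ℕ) : (ZMod p)ˣ →* MulAut (Multiplicative (ZMod p)) where
  toFun b :=
    { toFun := fun x => Multiplicative.ofAdd ((b : ZMod p) * x.toAdd)
      invFun := fun x => Multiplicative.ofAdd (((b⁻¹ : (ZMod p)ˣ) : ZMod p) * x.toAdd)
      left_inv := fun x => by simp
      right_inv := fun x => by simp
      map_mul' := fun x y => by simp [mul_add] }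
  map_one' := by ext x; simp
  map_mul' := fun a b => by ext x; simp [mul_assoc]

variable {p : ℕ}

theorem mulAction_apply (b : (ZMod p)ˣ) (x : Multiplicative (ZMod p)) :
    mulAction p b x = Multiplicative.ofAdd ((b : ZMod p) * x.toAdd) := rfl

/-- For a unit `k` of order `q` modulo the prime `p`, the non-abelian group `C_p ⋊ C_q` of
order `p * q`, where `C_q` is the subgroup generated by `k` and acts on `C_p` by
multiplication. -/
abbrev N (k : (ZMod p)ˣ) : Type :=
  Multiplicative (ZMod p) ⋊[(mulAction p).comp (Subgroup.zpowers k).subtype]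
    (Subgroup.zpowers k)

/-- The generator `σ` of `C_p`. -/
def σ (k : (ZMod p)ˣ) : N k := SemidirectProduct.inl (Multiplicative.ofAdd 1)

/-- The generator `τ` of `C_q`. -/
def τ (k : (ZMod p)ˣ) : N k :=
  SemidirectProduct.inr ⟨k, Subgroup.mem_zpowers k⟩

theorem σ_pow (k : (ZMod p)ˣ) (n : ℕ) :
    σ k ^ n = SemidirectProduct.inl (Multiplicative.ofAdd (n : ZMod p)) := by
  rw [σ, ← map_pow, ← ofAdd_nsmul, nsmul_one]

/-- The relation `τ σ = σ ^ k τ`. -/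
theorem τ_mul_σ [NeZero p] (k : (ZMod p)ˣ) :
    τ k * σ k = σ k ^ (k : ZMod p).val * τ k := by
  rw [σ_pow, ZMod.natCast_zmod_val]
  refine SemidirectProduct.ext ?_ ?_
  · simp [τ, σ, mulAction_apply]
  · simp [τ, σ]

/-- The automorphism of `N` with `σ ↦ σ ^ b` and `τ ↦ τ`. -/
def scaleAut (k b : (ZMod p)ˣ) : MulAut (N k) where
  toFun g := ⟨mulAction p b g.left, g.right⟩
  invFun g := ⟨mulAction p b⁻¹ g.left, g.right⟩
  left_inv g := by ext <;> simp
  right_inv g := by ext <;> simp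
  map_mul' g h := by
    refine SemidirectProduct.ext ?_ ?_
    · simp only [SemidirectProduct.mul_left, map_mul, MonoidHom.comp_apply]
      rw [← MulAut.mul_apply, ← MulAut.mul_apply, ← map_mul, ← map_mul,
        mul_comm b (Subgroup.subtype _ _)]
    · simp

/-- The automorphism `θ` of `N` with `θ σ = σ` and `θ τ = σ τ` (for `p` prime and `k ≠ 1`),
see `θ_σ` and `θ_τ`; it is conjugation by the power of `σ` with exponent `1 / (1 - k)`. -/
def θ (k : (ZMod p)ˣ) : MulAut (N k) :=
  MulAut.conj (SemidirectProduct.inl (Multiplicative.ofAdd (1 - (k : ZMod p))⁻¹))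

theorem θ_σ (k : (ZMod p)ˣ) : θ k (σ k) = σ k := by
  simp only [θ, σ, MulAut.conj_apply, ← map_inv, ← map_mul]
  rw [mul_inv_cancel_comm]

theorem θ_τ [Fact p.Prime] {k : (ZMod p)ˣ} (hk : k ≠ 1) : θ k (τ k) = σ k * τ k := by
  have h : (1 - (k : ZMod p)) ≠ 0 := by
    rw [sub_ne_zero]; exact fun h => hk (Units.ext h.symm)
  refine SemidirectProduct.ext ?_ ?_
  · apply Multiplicative.toAdd.injective
    simp only [θ, τ, σ, MulAut.conj_apply, ← map_inv]
    simp only [SemidirectProduct.mul_left, SemidirectProduct.mul_right,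
      SemidirectProduct.left_inl, SemidirectProduct.right_inl, SemidirectProduct.left_inr,
      SemidirectProduct.right_inr, map_one, mul_one, one_mul]
    simp only [mulAction, MonoidHom.comp_apply, MonoidHom.coe_mk, OneHom.coe_mk,
      Subgroup.coe_subtype, MulEquiv.coe_mk, Equiv.coe_fn_mk, toAdd_mul, toAdd_ofAdd, toAdd_inv]
    field_simp
    ring
  · simp [θ, τ, σ]

/-- The element `e₁ = σ` of `Hol(N)`. -/
def e₁ (k : (ZMod p)ˣ) : Hol (N k) := SemidirectProduct.inl (σ k)

/-- The element `e₂ = [σ, θ ^ (k - 1)]` of `Hol(N)`. -/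
def e₂ (k : (ZMod p)ˣ) : Hol (N k) := ⟨σ k, θ k ^ ((k : ZMod p) - 1).val⟩

/-- The element `T = τ` of `Hol(N)`. -/
def T (k : (ZMod p)ˣ) : Hol (N k) := SemidirectProduct.inl (τ k)

/-- The automorphism `σ ↦ σ ^ b`, `τ ↦ τ` of `N` as an element of `Hol(N)`. It acts by
conjugation on `e₁` and on `e₂` as the power `b`. It is the element `A` for `b = a_α` and
the element `B` for `b = a_β`. -/
def scale (k b : (ZMod p)ˣ) : Hol (N k) := SemidirectProduct.inr (scaleAut k b)

/-- The subgroup `P = ⟨e₁, e₂⟩ ≅ 𝔽_p²` of `Hol(N)`. -/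
def P (k : (ZMod p)ˣ) : Subgroup (Hol (N k)) := Subgroup.closure {e₁ k, e₂ k}

/-- The subgroup `P ⋊ ⟨T A ^ m, B ^ l⟩` of `Hol(N)`, where `A` and `B` act on `P` as
the scalars `aα` and `aβ`. -/
def transitiveSubgroup (k aα aβ : (ZMod p)ˣ) (m l : ℕ) : Subgroup (Hol (N k)) :=
  P k ⊔ Subgroup.closure {T k * scale k aα ^ m, scale k aβ ^ l}

end Metacyclic

/-! `G` is an affine group `𝔽_p² ⋊ ⟨g⟩` with `g = diag(k a b, a b)`, where `a = a_α^(u q^(e₀-c))`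
has order `q^c` and `b = a_β^(s/d)` satisfies `b^d = 1`. The complement is cyclic because `q` is
prime to `d`. All that matters about `g` is that the ratio `k` of its entries has order `q`, and
whether exchanging the entries of `g` gives a power of `g`.

Since the order of `g` is prime to `p` and `q < p`, a subgroup of index `pq` meets the plane in a
line and has linear parts of index `q` in `⟨g⟩`, which must be the scalars. A nontrivial scalar map
has a fixed point, so after a translation the subgroup is line ⋊ scalars (`exists_conj_eq_std`).
Scalars act alike on every line, whence one isomorphism class.

Diagonal matrices give automorphisms, and under them the lines fall into three orbits: the two axes
and all other lines. Conversely, any automorphism preserves the plane and permutes the eigenlines of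
`g`, that is, the axes; it can exchange them only if the swap of `g` lies in `⟨g⟩` (`axes_map`), and
then the exchange of coordinates does so. If the swap is `g^r`, then `r ≡ -1` mod `q`, and comparing
`q`-parts forces `c = 1` and `2u ≡ -1` mod `q` (`eq_one_and_of_swap_mem`). -/

namespace DiagModel

/-! ### The affine model and its standard subgroups. -/

variable {p : ℕ}

/-- The diagonal matrices over `ℤ/p` act on the (multiplicatively written) plane. -/
def diagAction (p : ℕ) :
    (ZMod p)ˣ × (ZMod p)ˣ →* MulAut (Multiplicative (ZMod p × ZMod p)) where
  toFun b :=
    { toFun := fun x => Multiplicative.ofAdd ((b.1 : ZMod p) * x.toAdd.1, (b.2 : ZMod p) * x.toAdd.2)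
      invFun := fun x => Multiplicative.ofAdd
        (((b.1⁻¹ : (ZMod p)ˣ) : ZMod p) * x.toAdd.1, ((b.2⁻¹ : (ZMod p)ˣ) : ZMod p) * x.toAdd.2)
      left_inv := fun x => by simp
      right_inv := fun x => by simp
      map_mul' := fun x y => by simp [mul_add, ← ofAdd_add] }
  map_one' := by ext x <;> simp
  map_mul' := fun a b => by ext x <;> simp [mul_assoc]

theorem diagAction_apply (b : (ZMod p)ˣ × (ZMod p)ˣ) (x : Multiplicative (ZMod p × ZMod p)) :
    diagAction p b x =
      Multiplicative.ofAdd ((b.1 : ZMod p) * x.toAdd.1, (b.2 : ZMod p) * x.toAdd.2) := rfl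

/-- The affine group with translations `𝔽_p²` and linear parts in the cyclic group of diagonal
matrices generated by `g`. -/
abbrev Model (g : (ZMod p)ˣ × (ZMod p)ˣ) : Type :=
  Multiplicative (ZMod p × ZMod p) ⋊[(diagAction p).comp (Subgroup.zpowers g).subtype]
    (Subgroup.zpowers g)

variable {g : (ZMod p)ˣ × (ZMod p)ˣ}

/-- Translation by `v`. -/
def shift (v : ZMod p × ZMod p) : Model g := SemidirectProduct.inl (Multiplicative.ofAdd v)

/-- The translation part of an affine map. -/
def vec (h : Model g) : ZMod p × ZMod p := h.left.toAdd

/-- The linear part of an affine map. -/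
def lin (h : Model g) : (ZMod p)ˣ × (ZMod p)ˣ := h.right

theorem model_ext {h h' : Model g} (hv : vec h = vec h') (hl : lin h = lin h') : h = h' :=
  SemidirectProduct.ext (Multiplicative.toAdd.injective hv) (Subtype.ext hl)

theorem lin_mem (h : Model g) : lin h ∈ Subgroup.zpowers g := h.right.2

@[simp] theorem vec_mul (h h' : Model g) : vec (h * h') =
    ((vec h).1 + (lin h).1 * (vec h').1, (vec h).2 + (lin h).2 * (vec h').2) := rfl

@[simp] theorem lin_mul (h h' : Model g) : lin (h * h') = lin h * lin h' := rfl

@[simp] theorem vec_one : vec (1 : Model g) = 0 := rfl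

@[simp] theorem lin_one : lin (1 : Model g) = 1 := rfl

@[simp] theorem vec_inv (h : Model g) : vec h⁻¹ =
    (-(((lin h).1⁻¹ : (ZMod p)ˣ) * (vec h).1), -(((lin h).2⁻¹ : (ZMod p)ˣ) * (vec h).2)) := by
  rw [← mul_neg, ← mul_neg]
  rfl

@[simp] theorem lin_inv (h : Model g) : lin h⁻¹ = (lin h)⁻¹ := rfl

@[simp] theorem vec_shift (v : ZMod p × ZMod p) : vec (shift v : Model g) = v := rfl

@[simp] theorem lin_shift (v : ZMod p × ZMod p) : lin (shift v : Model g) = 1 := rfl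

/-- The linear map `l`. -/
def ofLin (l : Subgroup.zpowers g) : Model g := SemidirectProduct.inr l

@[simp] theorem vec_ofLin (l : Subgroup.zpowers g) : vec (ofLin l) = 0 := rfl

@[simp] theorem lin_ofLin (l : Subgroup.zpowers g) : lin (ofLin l) = l := rfl

/-- The affine maps with translation part in the line `Q` and scalar linear part. -/
def std (g : (ZMod p)ˣ × (ZMod p)ˣ) (Q : Submodule (ZMod p) (ZMod p × ZMod p)) :
    Subgroup (Model g) where
  carrier := {h | vec h ∈ Q ∧ (lin h).1 = (lin h).2}
  one_mem' := by simp
  mul_mem' := by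
    rintro a b ⟨ha, ha'⟩ ⟨hb, hb'⟩
    refine ⟨?_, by simp [ha', hb']⟩
    have : vec (a * b) = vec a + ((lin a).2 : ZMod p) • vec b := by
      rw [vec_mul, ha']; rfl
    rw [this]
    exact Q.add_mem ha (Q.smul_mem _ hb)
  inv_mem' := by
    rintro a ⟨ha, ha'⟩
    refine ⟨?_, by simp [ha']⟩
    have : vec a⁻¹ = -((((lin a).2⁻¹ : (ZMod p)ˣ) : ZMod p) • vec a) := by
      rw [vec_inv, ha']; rfl
    rw [this]
    exact Q.neg_mem (Q.smul_mem _ ha)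

theorem mem_std {Q : Submodule (ZMod p) (ZMod p × ZMod p)} {h : Model g} :
    h ∈ std g Q ↔ vec h ∈ Q ∧ (lin h).1 = (lin h).2 := Iff.rfl

/-- The group of scalar matrices among the powers of `g`. -/
def scalars (g : (ZMod p)ˣ × (ZMod p)ˣ) : Subgroup (Subgroup.zpowers g) :=
  ((MonoidHom.fst (ZMod p)ˣ (ZMod p)ˣ / MonoidHom.snd (ZMod p)ˣ (ZMod p)ˣ).comp
    (Subgroup.zpowers g).subtype).ker

theorem mem_scalars {l : Subgroup.zpowers g} :
    l ∈ scalars g ↔ (l : (ZMod p)ˣ × (ZMod p)ˣ).1 = (l : (ZMod p)ˣ × (ZMod p)ˣ).2 := by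
  simp [scalars, MonoidHom.mem_ker, div_eq_one]

/-- The scalars are the kernel of the ratio of the two entries, whose image is generated by `g.1 /
g.2`. -/
theorem index_scalars : (scalars g).index = orderOf (g.1 / g.2) := by
  rw [scalars, Subgroup.index_ker, MonoidHom.range_comp, Subgroup.range_subtype,
    MonoidHom.map_zpowers, Nat.card_zpowers]
  rfl

theorem card_std (Q : Submodule (ZMod p) (ZMod p × ZMod p)) :
    Nat.card (std g Q) = Nat.card Q * Nat.card (scalars g) := by
  rw [← Nat.card_prod]
  refine Nat.card_congr ⟨fun h => (⟨vec h.1, h.2.1⟩, ⟨h.1.right, mem_scalars.2 h.2.2⟩),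
    fun x => ⟨⟨Multiplicative.ofAdd x.1.1, x.2.1⟩, x.1.2, mem_scalars.1 x.2.2⟩,
    fun h => rfl, fun x => rfl⟩

theorem card_model : Nat.card (Model g) = p ^ 2 * Nat.card (Subgroup.zpowers g) := by
  rw [SemidirectProduct.card]
  congr 1
  have : Nat.card (Multiplicative (ZMod p × ZMod p)) = Nat.card (ZMod p × ZMod p) := rfl
  rw [this, Nat.card_prod, Nat.card_zmod, sq]

variable [Fact p.Prime]

theorem index_std {Q : Submodule (ZMod p) (ZMod p × ZMod p)} (hQ : Nat.card Q = p) :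
    (std g Q).index = p * orderOf (g.1 / g.2) := by
  have h1 := (std g Q).card_mul_index
  have h2 := (scalars g).card_mul_index
  rw [card_std, hQ, card_model, ← h2, index_scalars] at h1
  have hp : 0 < p := (Fact.out : p.Prime).pos
  have : 0 < Nat.card (scalars g) := Nat.card_pos
  refine Nat.eq_of_mul_eq_mul_left (Nat.mul_pos hp this) ?_
  rw [h1]; ring

theorem card_span_singleton {w : ZMod p × ZMod p} (hw : w ≠ 0) :
    Nat.card (Submodule.span (ZMod p) {w}) = p := by
  have := Module.natCard_eq_pow_finrank (K := ZMod p) (V := Submodule.span (ZMod p) {w})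
  rw [this, finrank_span_singleton hw, Nat.card_zmod, pow_one]

theorem exists_eq_span_singleton {Q : Submodule (ZMod p) (ZMod p × ZMod p)} (hQ : Nat.card Q = p) :
    ∃ w ≠ 0, Q = Submodule.span (ZMod p) {w} := by
  have hp : 1 < p := (Fact.out : p.Prime).one_lt
  have hne : Q ≠ ⊥ := by
    rintro rfl
    have : Nat.card (⊥ : Submodule (ZMod p) (ZMod p × ZMod p)) = 1 := Nat.card_unique
    omega
  obtain ⟨w, hw, hw0⟩ := Q.exists_mem_ne_zero_of_ne_bot hne
  refine ⟨w, hw0, ?_⟩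
  have hle : Submodule.span (ZMod p) {w} ≤ Q := by simpa using hw
  symm
  apply SetLike.coe_injective
  refine Set.eq_of_subset_of_ncard_le hle ?_ (Set.toFinite _)
  change Nat.card Q ≤ Nat.card (Submodule.span (ZMod p) {w})
  rw [hQ, card_span_singleton hw0]

/-- The isomorphism type of `std g Q` does not depend on `Q`. -/
theorem nonempty_std_mulEquiv {Q Q' : Submodule (ZMod p) (ZMod p × ZMod p)}
    (hQ : Nat.card Q = p) (hQ' : Nat.card Q' = p) : Nonempty (std g Q ≃* std g Q') := by
  have hf : Module.finrank (ZMod p) Q = Module.finrank (ZMod p) Q' := by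
    obtain ⟨w, hw, rfl⟩ := exists_eq_span_singleton hQ
    obtain ⟨w', hw', rfl⟩ := exists_eq_span_singleton hQ'
    rw [finrank_span_singleton hw, finrank_span_singleton hw']
  let f : Q ≃ₗ[ZMod p] Q' := LinearEquiv.ofFinrankEq _ _ hf
  refine ⟨{ toFun := fun h => ⟨⟨Multiplicative.ofAdd (f ⟨vec h.1, h.2.1⟩).1, h.1.right⟩,
              (f ⟨vec h.1, h.2.1⟩).2, h.2.2⟩
            invFun := fun h => ⟨⟨Multiplicative.ofAdd (f.symm ⟨vec h.1, h.2.1⟩).1, h.1.right⟩,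
              (f.symm ⟨vec h.1, h.2.1⟩).2, h.2.2⟩
            left_inv := ?_
            right_inv := ?_
            map_mul' := ?_ }⟩
  · intro h
    refine Subtype.ext (model_ext ?_ rfl)
    exact congrArg Subtype.val (f.symm_apply_apply ⟨vec h.1, h.2.1⟩)
  · intro h
    refine Subtype.ext (model_ext ?_ rfl)
    exact congrArg Subtype.val (f.apply_symm_apply ⟨vec h.1, h.2.1⟩)
  · intro a b
    refine Subtype.ext (model_ext ?_ rfl)
    -- Scalar linear parts make the product `v + λ w` with a single `λ`, so every linear isomorphism
    -- of lines respects it.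
    have h1 : (⟨vec (a * b).1, (a * b).2.1⟩ : Q) =
        ⟨vec a.1, a.2.1⟩ + ((lin a.1).2 : ZMod p) • ⟨vec b.1, b.2.1⟩ := by
      apply Subtype.ext
      change vec (a.1 * b.1) = vec a.1 + ((lin a.1).2 : ZMod p) • vec b.1
      rw [vec_mul, a.2.2]; rfl
    have h2 : (f ⟨vec (a * b).1, (a * b).2.1⟩ : ZMod p × ZMod p) =
        f ⟨vec a.1, a.2.1⟩ + ((lin a.1).2 : ZMod p) • (f ⟨vec b.1, b.2.1⟩ : ZMod p × ZMod p) := by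
      rw [h1, map_add, map_smul]; rfl
    have aux : ∀ (v w : ZMod p × ZMod p) (x y : (ZMod p)ˣ), x = y →
        v + (y : ZMod p) • w = (v.1 + x * w.1, v.2 + y * w.2) := by
      rintro v w x y rfl
      rfl
    exact h2.trans (aux _ _ _ _ a.2.2)

end DiagModel

/-! ### Classification of the subgroups of index `pq` up to translation. -/

/-- Normality of `K` gives `[HK : K] = [H : H ∩ K]`; counting orders in two ways turns this into the
same identity with `H` and `K` exchanged. -/
theorem Subgroup.relIndex_sup_eq_of_normal {G : Type*} [Group G] [Finite G] (H K : Subgroup G)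
    [K.Normal] : H.relIndex (H ⊔ K) = H.relIndex K := by
  have h1 := Subgroup.relIndex_mul_relIndex ⊥ H (H ⊔ K) bot_le le_sup_left
  have h2 := Subgroup.relIndex_mul_relIndex ⊥ K (H ⊔ K) bot_le le_sup_right
  have h3 := Subgroup.relIndex_mul_relIndex ⊥ (H ⊓ K) H bot_le inf_le_left
  have h4 := Subgroup.relIndex_mul_relIndex ⊥ (H ⊓ K) K bot_le inf_le_right
  simp only [Subgroup.relIndex_bot_left, Subgroup.inf_relIndex_left, Subgroup.inf_relIndex_right,
    Subgroup.relIndex_sup_right] at h1 h2 h3 h4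
  have h5 : 0 < Nat.card (H ⊓ K : Subgroup G) := Nat.card_pos
  have h6 : 0 < Nat.card H := Nat.card_pos
  refine Nat.eq_of_mul_eq_mul_left h6 ?_
  rw [h1, ← h2, ← h3, ← h4]
  ring

namespace DiagModel

variable {p : ℕ} {g : (ZMod p)ˣ × (ZMod p)ˣ}

instance [NeZero p] : Finite (Model g) := Finite.of_equiv _ SemidirectProduct.equivProd.symm

theorem mem_scalars_iff_exists_zpow {l : Subgroup.zpowers g} :
    l ∈ scalars g ↔ ∃ n : ℤ, (l : (ZMod p)ˣ × (ZMod p)ˣ) = (g ^ orderOf (g.1 / g.2)) ^ n := by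
  rw [mem_scalars]
  obtain ⟨l, m, rfl⟩ := l
  constructor
  · intro h
    have h1 : (g.1 / g.2) ^ m = 1 := by
      rw [div_zpow, div_eq_one]; exact h
    obtain ⟨n, rfl⟩ := orderOf_dvd_iff_zpow_eq_one.2 h1
    exact ⟨n, by simp [zpow_mul]⟩
  · rintro ⟨n, h⟩
    have h1 : (g.1 / g.2) ^ orderOf (g.1 / g.2) = 1 := pow_orderOf_eq_one _
    rw [div_pow, div_eq_one] at h1
    have h2 : g ^ m = (g ^ orderOf (g.1 / g.2)) ^ n := h
    change (g ^ m).1 = (g ^ m).2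
    rw [h2]
    change (g.1 ^ _) ^ n = (g.2 ^ _) ^ n
    rw [h1]

/-- A subgroup of index `n` contains `g ^ n`. For `n` the order of the ratio, this power generates
the scalars, and equality follows from equal indices. -/
theorem eq_scalars_of_index_eq [NeZero p] {J : Subgroup (Subgroup.zpowers g)}
    (hJ : J.index = orderOf (g.1 / g.2)) : J = scalars g := by
  have hle : scalars g ≤ J := by
    intro l hl
    obtain ⟨n, hn⟩ := mem_scalars_iff_exists_zpow.1 hl
    have h1 : (⟨g, Subgroup.mem_zpowers g⟩ : Subgroup.zpowers g) ^ J.index ∈ J :=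
      J.pow_index_mem _
    rw [hJ] at h1
    convert J.zpow_mem h1 n using 1
    exact Subtype.ext (by simpa using hn)
  refine le_antisymm ?_ hle
  rw [← Subgroup.relIndex_eq_one]
  have h2 := Subgroup.relIndex_mul_index hle
  rw [hJ, index_scalars] at h2
  have : 0 < orderOf (g.1 / g.2) := orderOf_pos _
  exact Nat.eq_of_mul_eq_mul_right this (by rw [h2, one_mul])

variable [Fact p.Prime]

/-- The entries are units modulo `p`, so the order of `g` divides `p - 1`. -/
theorem coprime_card_zpowers : p.Coprime (Nat.card (Subgroup.zpowers g)) := by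
  have hp : p.Prime := Fact.out
  have h1 : g ^ (p - 1) = 1 := by
    refine Prod.ext ?_ ?_ <;> exact ZMod.units_pow_card_sub_one_eq_one p _
  rw [Nat.card_zpowers]
  refine Nat.Coprime.coprime_dvd_right (orderOf_dvd_of_pow_eq_one h1) ?_
  refine hp.coprime_iff_not_dvd.2 ?_
  intro h
  have := Nat.le_of_dvd (Nat.sub_pos_of_lt hp.one_lt) h
  have := hp.pos
  omega

variable {H : Subgroup (Model g)} {q : ℕ}

/-- The index `pq` factors as `a * b`, with `a ∣ p ^ 2` from the plane and `b` prime to `p` from the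
linear parts. So `p ∣ a`, and `a = p ^ 2` is excluded by `q < p`. -/
theorem index_map_rightHom_and_comap_inl (hq : q.Prime) (hqp : q < p) (hH : H.index = p * q) :
    (H.map SemidirectProduct.rightHom).index = q ∧ (H.comap SemidirectProduct.inl).index = p := by
  have hp : p.Prime := Fact.out
  have h1 : H.relIndex (H ⊔ SemidirectProduct.rightHom.ker) * _ = _ :=
    Subgroup.relIndex_mul_index le_sup_left
  rw [Subgroup.relIndex_sup_eq_of_normal, hH] at h1
  have h2 := H.index_map (SemidirectProduct.rightHom : Model g →* _)
  rw [MonoidHom.range_eq_top.2 SemidirectProduct.rightHom_surjective, Subgroup.index_top,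
    mul_one] at h2
  rw [← h2, ← SemidirectProduct.range_inl_eq_ker_rightHom, ← Subgroup.index_comap] at h1
  set a := (H.comap SemidirectProduct.inl).index
  set b := (H.map SemidirectProduct.rightHom).index
  have ha : a ∣ p ^ 2 := by
    have h3 : a ∣ Nat.card (Multiplicative (ZMod p × ZMod p)) := Subgroup.index_dvd_card _
    have : Nat.card (Multiplicative (ZMod p × ZMod p)) = Nat.card (ZMod p × ZMod p) := rfl
    rwa [this, Nat.card_prod, Nat.card_zmod, ← sq] at h3
  have hb : p.Coprime b := coprime_card_zpowers.coprime_dvd_right (Subgroup.index_dvd_card _)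
  have hpa : p ∣ a := hb.dvd_of_dvd_mul_right (h1 ▸ dvd_mul_right p q)
  obtain ⟨r, hr⟩ := hpa
  rw [hr, mul_assoc] at h1
  have h4 := Nat.eq_of_mul_eq_mul_left hp.pos h1
  have hrp : r ∣ p := by
    rw [hr, sq] at ha
    exact Nat.dvd_of_mul_dvd_mul_left hp.pos ha
  have hr1 : r = 1 := by
    rcases (Nat.dvd_prime hp).1 hrp with h | h
    · exact h
    · have := Nat.le_of_dvd hq.pos (h4 ▸ dvd_mul_right r b)
      omega
  subst hr1
  omega

/-- Every subgroup of index `p * q` is conjugate by a translation to a standard one. -/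
theorem exists_conj_eq_std (hq : q.Prime) (hqp : q < p) (hg : orderOf (g.1 / g.2) = q)
    (hH : H.index = p * q) :
    ∃ t : Model g, ∃ Q : Submodule (ZMod p) (ZMod p × ZMod p), Nat.card Q = p ∧
      H.map (MulAut.conj t).toMonoidHom = std g Q := by
  have key : ∀ H : Subgroup (Model g), H.index = p * q →
      H.map SemidirectProduct.rightHom = scalars g := fun H hH =>
    eq_scalars_of_index_eq ((index_map_rightHom_and_comap_inl hq hqp hH).1.trans hg.symm)
  let l₀ : Subgroup.zpowers g := ⟨g ^ q, Subgroup.npow_mem_zpowers g q⟩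
  have hl₀ : l₀ ∈ scalars g := mem_scalars_iff_exists_zpow.2 ⟨1, by simp [l₀, hg]⟩
  obtain ⟨t, h₀, hh₀, ht⟩ : ∃ t : Model g, ∃ h₀ ∈ H, t * h₀ * t⁻¹ = ofLin l₀ := by
    -- Here the only scalar is the identity and nothing has to be moved.
    by_cases h1 : l₀ = 1
    · exact ⟨1, 1, H.one_mem, by rw [h1, ofLin, map_one]; simp⟩
    obtain ⟨h₀, hh₀, hr₀⟩ : l₀ ∈ H.map SemidirectProduct.rightHom := by rwa [key H hH]
    have hlin : lin h₀ = g ^ q := congrArg Subtype.val hr₀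
    have hsc : (g ^ q).1 = (g ^ q).2 := mem_scalars.1 hl₀
    have hne : 1 - ((g ^ q).2 : ZMod p) ≠ 0 := by
      intro h2
      have h3 : (g ^ q).2 = 1 := Units.ext (sub_eq_zero.1 h2).symm
      exact h1 (Subtype.ext (Prod.ext (hsc.trans h3) h3))
    -- With `λ` the scalar of `g ^ q`, the map `x ↦ λ x + v` fixes `(1 - λ)⁻¹ v`; the translation
    -- carries this point to the origin.
    refine ⟨shift (-((1 - ((g ^ q).2 : ZMod p))⁻¹ • vec h₀)), h₀, hh₀, model_ext ?_ ?_⟩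
    · simp only [vec_mul, vec_inv, lin_mul, vec_shift, lin_shift, hlin, vec_ofLin]
      refine Prod.ext ?_ ?_ <;> simp only [Prod.fst_neg, Prod.snd_neg, Prod.smul_fst,
        Prod.smul_snd, smul_eq_mul, Prod.fst_one, Prod.snd_one,
        one_mul, inv_one, Units.val_one, Prod.fst_zero, Prod.snd_zero, hsc] <;> field_simp <;> ring
    · simp [hlin, l₀]
  let H' := H.map (MulAut.conj t).toMonoidHom
  have hH' : H'.index = p * q := by
    rw [← hH]; exact Subgroup.index_map_equiv H (MulAut.conj t)
  have hmem : ofLin l₀ ∈ H' := ⟨h₀, hh₀, by simpa using ht⟩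
  have hsmem : ∀ l ∈ scalars g, ofLin l ∈ H' := by
    intro l hl
    obtain ⟨n, hn⟩ := mem_scalars_iff_exists_zpow.1 hl
    have : l = l₀ ^ n := Subtype.ext (by rw [hn, hg]; rfl)
    rw [this, ofLin, map_zpow]
    exact H'.zpow_mem hmem n
  -- The translations in the conjugate; over the prime field an additive subgroup is a subspace.
  let Q : Submodule (ZMod p) (ZMod p × ZMod p) :=
    AddSubgroup.toZModSubmodule p (Subgroup.toAddSubgroup' (H'.comap SemidirectProduct.inl))
  have hQ : ∀ v, v ∈ Q ↔ shift v ∈ H' := fun v => Iff.rfl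
  refine ⟨t, Q, ?_, ?_⟩
  · have h1 := (H'.comap (SemidirectProduct.inl : _ →* Model g)).card_mul_index
    rw [(index_map_rightHom_and_comap_inl hq hqp hH').2] at h1
    have : Nat.card (Multiplicative (ZMod p × ZMod p)) = Nat.card (ZMod p × ZMod p) := rfl
    rw [this, Nat.card_prod, Nat.card_zmod] at h1
    exact Nat.eq_of_mul_eq_mul_right (Fact.out : p.Prime).pos h1
  · ext h
    rw [mem_std, hQ]
    have hdec : h = shift (vec h) * ofLin h.right :=
      (SemidirectProduct.inl_left_mul_inr_right h).symm
    constructor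
    · intro hh
      have hl : h.right ∈ scalars g := by
        rw [← key H' hH']; exact ⟨h, hh, rfl⟩
      refine ⟨?_, mem_scalars.1 hl⟩
      have h3 : shift (vec h) = h * (ofLin h.right)⁻¹ := by
        rw [eq_mul_inv_iff_mul_eq]; exact hdec.symm
      rw [h3]
      exact H'.mul_mem hh (H'.inv_mem (hsmem _ hl))
    · rintro ⟨h1, h2⟩
      rw [hdec]
      exact H'.mul_mem h1 (hsmem _ (mem_scalars.2 h2))

end DiagModel

/-! ### Automorphisms of the model. -/

namespace DiagModel

variable {p : ℕ} {g : (ZMod p)ˣ × (ZMod p)ˣ}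

/-- Conjugation by the diagonal matrix `δ`. -/
def diagAut (g δ : (ZMod p)ˣ × (ZMod p)ˣ) : Model g ≃* Model g where
  toFun h := ⟨diagAction p δ h.left, h.right⟩
  invFun h := ⟨diagAction p δ⁻¹ h.left, h.right⟩
  left_inv h := by
    refine SemidirectProduct.ext ?_ rfl
    change (diagAction p δ⁻¹ * diagAction p δ) h.left = _
    rw [← map_mul, inv_mul_cancel, map_one]; rfl
  right_inv h := by
    refine SemidirectProduct.ext ?_ rfl
    change (diagAction p δ * diagAction p δ⁻¹) h.left = _
    rw [← map_mul, mul_inv_cancel, map_one]; rfl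
  map_mul' a b := by
    refine SemidirectProduct.ext ?_ rfl
    change diagAction p δ (a.left * diagAction p a.right b.left) =
      diagAction p δ a.left * (diagAction p a.right * diagAction p δ) b.left
    rw [map_mul, ← map_mul (diagAction p), mul_comm (a.right : (ZMod p)ˣ × (ZMod p)ˣ),
      map_mul (diagAction p)]
    rfl

@[simp] theorem vec_diagAut (δ : (ZMod p)ˣ × (ZMod p)ˣ) (h : Model g) :
    vec (diagAut g δ h) = (δ.1 * (vec h).1, δ.2 * (vec h).2) := rfl

theorem swap_mem_zpowers (hs : g.swap ∈ Subgroup.zpowers g) {l : (ZMod p)ˣ × (ZMod p)ˣ}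
    (hl : l ∈ Subgroup.zpowers g) : l.swap ∈ Subgroup.zpowers g := by
  obtain ⟨n, rfl⟩ := hl
  exact (Subgroup.zpowers g).zpow_mem hs n

/-- Exchanging the two coordinates. -/
def swapAut (hs : g.swap ∈ Subgroup.zpowers g) : Model g ≃* Model g where
  toFun h := ⟨Multiplicative.ofAdd (vec h).swap, ⟨(lin h).swap, swap_mem_zpowers hs (lin_mem h)⟩⟩
  invFun h := ⟨Multiplicative.ofAdd (vec h).swap, ⟨(lin h).swap, swap_mem_zpowers hs (lin_mem h)⟩⟩
  left_inv _ := rfl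
  right_inv _ := rfl
  map_mul' _ _ := rfl

@[simp] theorem vec_swapAut (hs : g.swap ∈ Subgroup.zpowers g) (h : Model g) :
    vec (swapAut hs h) = (vec h).swap := rfl

theorem map_diagAut_std (δ : (ZMod p)ˣ × (ZMod p)ˣ) (w : ZMod p × ZMod p) :
    (std g (Submodule.span (ZMod p) {w})).map (diagAut g δ).toMonoidHom =
      std g (Submodule.span (ZMod p) {((δ.1 : ZMod p) * w.1, (δ.2 : ZMod p) * w.2)}) := by
  ext h
  simp only [Subgroup.mem_map, mem_std, Submodule.mem_span_singleton]
  constructor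
  · rintro ⟨h, ⟨⟨a, ha⟩, h2⟩, rfl⟩
    refine ⟨⟨a, ?_⟩, h2⟩
    change _ = vec (diagAut g δ h)
    rw [vec_diagAut, ← ha]
    refine Prod.ext ?_ ?_ <;> simp <;> ring
  · rintro ⟨⟨a, ha⟩, h2⟩
    refine ⟨(diagAut g δ).symm h, ⟨⟨a, ?_⟩, h2⟩, (diagAut g δ).apply_symm_apply h⟩
    change a • w = (((δ.1⁻¹ : (ZMod p)ˣ) : ZMod p) * (vec h).1,
      ((δ.2⁻¹ : (ZMod p)ˣ) : ZMod p) * (vec h).2)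
    rw [← ha]
    refine Prod.ext ?_ ?_ <;> simp [mul_left_comm a]

theorem map_swapAut_std (hs : g.swap ∈ Subgroup.zpowers g) (w : ZMod p × ZMod p) :
    (std g (Submodule.span (ZMod p) {w})).map (swapAut hs).toMonoidHom =
      std g (Submodule.span (ZMod p) {w.swap}) := by
  ext h
  simp only [Subgroup.mem_map, mem_std, Submodule.mem_span_singleton]
  constructor
  · rintro ⟨h, ⟨⟨a, ha⟩, h2⟩, rfl⟩
    refine ⟨⟨a, ?_⟩, h2.symm⟩
    change _ = vec (swapAut hs h)
    rw [vec_swapAut, ← ha]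
    rfl
  · rintro ⟨⟨a, ha⟩, h2⟩
    refine ⟨(swapAut hs).symm h, ⟨⟨a, ?_⟩, h2.symm⟩, (swapAut hs).apply_symm_apply h⟩
    change a • w = (vec h).swap
    rw [← ha]
    rfl

theorem lin_pow (h : Model g) (n : ℕ) : lin (h ^ n) = lin h ^ n := by
  induction n with
  | zero => simp
  | succ n ih => simp [pow_succ, ih]

theorem vec_pow {h : Model g} (hh : lin h = 1) (n : ℕ) : vec (h ^ n) = (n : ZMod p) • vec h := by
  induction n with
  | zero => simp
  | succ n ih =>
    rw [pow_succ, vec_mul, ih, lin_pow, hh]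
    refine Prod.ext ?_ ?_ <;> simp <;> ring

theorem vec_conj {x h : Model g} (hh : lin h = 1) :
    vec (x * h * x⁻¹) = ((lin x).1 * (vec h).1, (lin x).2 * (vec h).2) := by
  simp [hh]

variable [Fact p.Prime] (φ : Model g ≃* Model g)

/-- Translations have order dividing `p`, whereas the order of a linear part is prime to `p`; hence
automorphisms preserve the plane. -/
theorem lin_map_eq_one {h : Model g} (hh : lin h = 1) : lin (φ h) = 1 := by
  have h1 : h ^ p = 1 := model_ext (by rw [vec_pow hh]; simp) (by rw [lin_pow, hh, one_pow]; rfl)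
  have h2 : lin (φ h) ^ p = 1 := by rw [← lin_pow, ← map_pow, h1, map_one]; rfl
  have h3 : lin (φ h) ^ Nat.card (Subgroup.zpowers g) = 1 := by
    have := pow_card_eq_one' (x := (φ h).right)
    exact congrArg Subtype.val this
  have := (coprime_card_zpowers (g := g)).symm
  have h4 : orderOf (lin (φ h)) ∣ 1 := by
    rw [← this]
    exact Nat.dvd_gcd (orderOf_dvd_of_pow_eq_one h3) (orderOf_dvd_of_pow_eq_one h2)
  exact orderOf_eq_one_iff.1 (Nat.dvd_one.1 h4)

/-- Being an eigenvector is the group relation `x * w * x⁻¹ = w ^ a`, which `φ` transports with the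
same eigenvalue. -/
theorem eigen_map {x : Model g} {w : ZMod p × ZMod p} {a : ZMod p}
    (h1 : ((lin x).1 : ZMod p) * w.1 = a * w.1) (h2 : ((lin x).2 : ZMod p) * w.2 = a * w.2) :
    ((lin (φ x)).1 : ZMod p) * (vec (φ (shift w))).1 = a * (vec (φ (shift w))).1 ∧
    ((lin (φ x)).2 : ZMod p) * (vec (φ (shift w))).2 = a * (vec (φ (shift w))).2 := by
  have h3 : x * shift w * x⁻¹ = shift w ^ a.val := by
    refine model_ext ?_ ?_
    · rw [vec_conj rfl, vec_pow rfl, ZMod.natCast_zmod_val]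
      exact Prod.ext h1 h2
    · rw [lin_pow]; simp
  have h4 := congrArg (fun h => vec (φ h)) h3
  have h5 : lin (φ (shift w)) = 1 := lin_map_eq_one φ rfl
  simp only [map_mul, map_inv, map_pow, vec_conj h5, vec_pow h5, ZMod.natCast_zmod_val] at h4
  exact ⟨congrArg Prod.fst h4, congrArg Prod.snd h4⟩

theorem vec_map_shift_ne_zero {w : ZMod p × ZMod p} (hw : w ≠ 0) : vec (φ (shift w)) ≠ 0 := by
  intro h
  have h1 : φ (shift w) = 1 := model_ext h (lin_map_eq_one φ rfl)
  rw [map_eq_one_iff φ φ.injective] at h1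
  exact hw (congrArg vec h1)

/-- Automorphisms permute the two coordinate axes, and preserve both of them unless
the group of linear parts is stable under exchanging the coordinates. -/
theorem axes_map (hg : g.1 ≠ g.2) :
    ((vec (φ (shift (1, 0)))).1 ≠ 0 ∧ (vec (φ (shift (1, 0)))).2 = 0 ∧
      (vec (φ (shift (0, 1)))).1 = 0 ∧ (vec (φ (shift (0, 1)))).2 ≠ 0) ∨
    ((vec (φ (shift (1, 0)))).1 = 0 ∧ (vec (φ (shift (1, 0)))).2 ≠ 0 ∧
      g.swap ∈ Subgroup.zpowers g) := by
  let x : Model g := ofLin ⟨g, Subgroup.mem_zpowers g⟩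
  have hx : lin x = g := rfl
  have hy := lin_mem (φ x)
  obtain ⟨a1, a2⟩ := eigen_map φ (x := x) (w := (1, 0)) (a := g.1) (by simp [hx]) (by simp)
  obtain ⟨b1, b2⟩ := eigen_map φ (x := x) (w := (0, 1)) (a := g.2) (by simp) (by simp [hx])
  have a3 := vec_map_shift_ne_zero φ (w := (1, 0)) (by simp)
  have b3 := vec_map_shift_ne_zero φ (w := (0, 1)) (by simp)
  generalize vec (φ (shift (1, 0))) = v at *
  generalize vec (φ (shift (0, 1))) = v' at *
  generalize lin (φ x) = y at *
  simp only [mul_eq_mul_right_iff, Units.val_inj] at a1 a2 b1 b2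
  have a4 : v.1 ≠ 0 ∨ v.2 ≠ 0 := by
    by_contra! h; exact a3 (Prod.ext h.1 h.2)
  have b4 : v'.1 ≠ 0 ∨ v'.2 ≠ 0 := by
    by_contra! h; exact b3 (Prod.ext h.1 h.2)
  by_cases hv : v.1 = 0
  · right
    have hv2 : v.2 ≠ 0 := by tauto
    have hy2 : y.2 = g.1 := by tauto
    -- The eigenvalues of `φ x` are now `g.1` on the second axis and, by elimination, `g.2` on the
    -- first: `φ x` has linear part the swap of `g`.
    have hv2' : v'.2 = 0 := b2.resolve_left (by rw [hy2]; exact hg)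
    have hy1 : y.1 = g.2 := by tauto
    refine ⟨hv, hv2, ?_⟩
    rwa [show g.swap = y from Prod.ext hy1.symm hy2.symm]
  · left
    have hy1 : y.1 = g.1 := by tauto
    have hv1' : v'.1 = 0 := b1.resolve_left (by rw [hy1]; exact hg)
    have hy2 : y.2 = g.2 := by tauto
    refine ⟨hv, a2.resolve_left (by rw [hy2]; exact hg.symm), hv1', by tauto⟩

end DiagModel

/-! ### Counting classes and orbits in the model. -/

theorem numAutOrbits_congr {G G' : Type*} [Group G] [Group G'] (e : G ≃* G') (n : ℕ) :
    numAutOrbits G n = numAutOrbits G' n := by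
  refine Nat.card_congr (Quotient.congr
    (e.mapSubgroup.toEquiv.subtypeEquiv fun H => ?_) ?_)
  · change _ ↔ (H.map e.toMonoidHom).index = n
    rw [show (H.map e.toMonoidHom).index = H.index from Subgroup.index_map_equiv H e]
  · intro H₁ H₂
    change (∃ φ : G ≃* G, H₁.1.map φ.toMonoidHom = H₂.1) ↔
      ∃ φ : G' ≃* G', (H₁.1.map e.toMonoidHom).map φ.toMonoidHom = H₂.1.map e.toMonoidHom
    constructor
    · rintro ⟨φ, h⟩
      refine ⟨(e.symm.trans φ).trans e, ?_⟩
      rw [← h, Subgroup.map_map, Subgroup.map_map]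
      congr 1
      ext x
      simp
    · rintro ⟨φ, h⟩
      refine ⟨(e.trans φ).trans e.symm, ?_⟩
      apply Subgroup.map_injective (f := e.toMonoidHom) e.injective
      rw [← h, Subgroup.map_map, Subgroup.map_map]
      congr 1
      ext x
      simp

theorem numIsoClasses_congr {G G' : Type*} [Group G] [Group G'] (e : G ≃* G') (n : ℕ) :
    numIsoClasses G n = numIsoClasses G' n := by
  refine Nat.card_congr (Quotient.congr
    (e.mapSubgroup.toEquiv.subtypeEquiv fun H => ?_) ?_)
  · change _ ↔ (H.map e.toMonoidHom).index = n
    rw [show (H.map e.toMonoidHom).index = H.index from Subgroup.index_map_equiv H e]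
  · intro H₁ H₂
    change Nonempty (H₁.1 ≃* H₂.1) ↔
      Nonempty (H₁.1.map e.toMonoidHom ≃* H₂.1.map e.toMonoidHom)
    let f₁ : H₁.1 ≃* H₁.1.map e.toMonoidHom := e.subgroupMap H₁.1
    let f₂ : H₂.1 ≃* H₂.1.map e.toMonoidHom := e.subgroupMap H₂.1
    exact ⟨fun ⟨f⟩ => ⟨(f₁.symm.trans f).trans f₂⟩, fun ⟨f⟩ => ⟨(f₁.trans f).trans f₂.symm⟩⟩

namespace DiagModel

variable {p : ℕ} {g : (ZMod p)ˣ × (ZMod p)ˣ} {q : ℕ}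

theorem fst_ne_snd (hq : q.Prime) (hg : orderOf (g.1 / g.2) = q) : g.1 ≠ g.2 := by
  intro h
  rw [h, div_self', orderOf_one] at hg
  exact hq.one_lt.ne hg

variable [Fact p.Prime]

theorem numIsoClasses_model (hq : q.Prime) (hqp : q < p) (hg : orderOf (g.1 / g.2) = q) :
    numIsoClasses (Model g) (p * q) = 1 := by
  rw [numIsoClasses, Nat.card_eq_one_iff_unique]
  constructor
  · constructor
    intro a b
    induction a using Quotient.inductionOn with | _ H₁
    induction b using Quotient.inductionOn with | _ H₂
    apply Quotient.sound
    obtain ⟨t₁, Q₁, hQ₁, h₁⟩ := exists_conj_eq_std hq hqp hg H₁.2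
    obtain ⟨t₂, Q₂, hQ₂, h₂⟩ := exists_conj_eq_std hq hqp hg H₂.2
    obtain ⟨f⟩ := nonempty_std_mulEquiv (g := g) hQ₁ hQ₂
    let f₁ : H₁.1 ≃* std g Q₁ :=
      ((MulAut.conj t₁).subgroupMap H₁.1).trans (MulEquiv.subgroupCongr h₁)
    let f₂ : H₂.1 ≃* std g Q₂ :=
      ((MulAut.conj t₂).subgroupMap H₂.1).trans (MulEquiv.subgroupCongr h₂)
    exact ⟨(f₁.trans f).trans f₂.symm⟩
  · refine ⟨Quotient.mk _ ⟨std g (Submodule.span (ZMod p) {(1, 0)}), ?_⟩⟩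
    rw [index_std (card_span_singleton (by simp)), hg]

/-- Representatives of the orbits of lines under diagonal matrices. -/
def repVec (p : ℕ) : Fin 3 → ZMod p × ZMod p := ![(1, 0), (1, 1), (0, 1)]

theorem repVec_ne_zero (i : Fin 3) : repVec p i ≠ 0 := by
  fin_cases i <;> simp [repVec]

/-- The standard subgroup of index `p * q` on a representative line. -/
def rep (hg : orderOf (g.1 / g.2) = q) (i : Fin 3) :
    {H : Subgroup (Model g) // H.index = p * q} :=
  ⟨std g (Submodule.span (ZMod p) {repVec p i}), by
    rw [index_std (card_span_singleton (repVec_ne_zero i)), hg]⟩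

theorem exists_rel_rep (hq : q.Prime) (hqp : q < p) (hg : orderOf (g.1 / g.2) = q)
    (H : {H : Subgroup (Model g) // H.index = p * q}) :
    ∃ i, (autOrbitSetoid (Model g) (p * q)) (rep hg i) H := by
  obtain ⟨t, Q, hQ, h⟩ := exists_conj_eq_std hq hqp hg H.2
  obtain ⟨w, hw, rfl⟩ := exists_eq_span_singleton hQ
  -- A diagonal matrix reaches any vector from the representative with the same vanishing
  -- coordinates.
  have key : ∃ i, ∃ δ : (ZMod p)ˣ × (ZMod p)ˣ,
      ((δ.1 : ZMod p) * (repVec p i).1, (δ.2 : ZMod p) * (repVec p i).2) = w := by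
    obtain ⟨a, b⟩ := w
    by_cases ha : a = 0
    · have hb : b ≠ 0 := by rintro rfl; exact hw (by rw [ha]; rfl)
      exact ⟨2, (1, Units.mk0 b hb), by simp [repVec, ha]⟩
    · by_cases hb : b = 0
      · exact ⟨0, (Units.mk0 a ha, 1), by simp [repVec, hb]⟩
      · exact ⟨1, (Units.mk0 a ha, Units.mk0 b hb), by simp [repVec]⟩
  obtain ⟨i, δ, hδ⟩ := key
  refine ⟨i, (autOrbitSetoid (Model g) (p * q)).trans'
    (y := ⟨_, (index_std hQ).trans (by rw [hg])⟩) ⟨diagAut g δ, ?_⟩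
    ((autOrbitSetoid (Model g) (p * q)).symm' ⟨MulAut.conj t, h⟩)⟩
  rw [rep, map_diagAut_std, hδ]

theorem vec_map_mem_of_rel {hg : orderOf (g.1 / g.2) = q} {i j : Fin 3}
    (h : (autOrbitSetoid (Model g) (p * q)) (rep hg i) (rep hg j)) :
    ∃ φ : Model g ≃* Model g,
      vec (φ (shift (repVec p i))) ∈ Submodule.span (ZMod p) {repVec p j} := by
  obtain ⟨φ, h⟩ := h
  have h1 : φ (shift (repVec p i)) ∈ (rep hg j).1 := by
    rw [← h]
    exact ⟨_, ⟨Submodule.mem_span_singleton_self _, rfl⟩, rfl⟩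
  exact ⟨φ, h1.1⟩

/-- The image of `(1, 0)` has exactly one nonzero coordinate, while a vector of the diagonal has
both or none. -/
theorem not_rel_rep_zero_one (hq : q.Prime) (hg : orderOf (g.1 / g.2) = q) :
    ¬ (autOrbitSetoid (Model g) (p * q)) (rep hg 0) (rep hg 1) := by
  intro h
  obtain ⟨φ, h⟩ := vec_map_mem_of_rel h
  obtain ⟨a, ha⟩ := Submodule.mem_span_singleton.1 h
  have h1 := congrArg Prod.fst ha
  have h2 := congrArg Prod.snd ha
  have := axes_map φ (fst_ne_snd hq hg)
  simp only [repVec, Matrix.cons_val, Prod.smul_fst, Prod.smul_snd, smul_eq_mul, mul_one] at h1 h2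
  rw [← h1, ← h2] at this
  tauto

theorem not_rel_rep_zero_two (hq : q.Prime) (hg : orderOf (g.1 / g.2) = q)
    (hs : g.swap ∉ Subgroup.zpowers g) :
    ¬ (autOrbitSetoid (Model g) (p * q)) (rep hg 0) (rep hg 2) := by
  intro h
  obtain ⟨φ, h⟩ := vec_map_mem_of_rel h
  obtain ⟨a, ha⟩ := Submodule.mem_span_singleton.1 h
  have h1 := congrArg Prod.fst ha
  have := axes_map φ (fst_ne_snd hq hg)
  simp only [repVec, Matrix.cons_val, Prod.smul_fst, smul_eq_mul, mul_zero] at h1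
  rw [← h1] at this
  tauto

/-- Stated from the axis to the diagonal because `axes_map` describes images of axis vectors. -/
theorem not_rel_rep_two_one (hq : q.Prime) (hg : orderOf (g.1 / g.2) = q)
    (hs : g.swap ∉ Subgroup.zpowers g) :
    ¬ (autOrbitSetoid (Model g) (p * q)) (rep hg 2) (rep hg 1) := by
  intro h
  obtain ⟨φ, h⟩ := vec_map_mem_of_rel h
  obtain ⟨a, ha⟩ := Submodule.mem_span_singleton.1 h
  have h1 := congrArg Prod.fst ha
  have h2 := congrArg Prod.snd ha
  have := axes_map φ (fst_ne_snd hq hg)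
  simp only [repVec, Matrix.cons_val, Prod.smul_fst, Prod.smul_snd, smul_eq_mul, mul_one] at h1 h2
  rw [← h1, ← h2] at this
  tauto

theorem numAutOrbits_model_of_not_mem (hq : q.Prime) (hqp : q < p)
    (hg : orderOf (g.1 / g.2) = q) (hs : g.swap ∉ Subgroup.zpowers g) :
    numAutOrbits (Model g) (p * q) = 3 := by
  let S := autOrbitSetoid (Model g) (p * q)
  have h01 := not_rel_rep_zero_one hq hg
  have h02 := not_rel_rep_zero_two hq hg hs
  have h21 := not_rel_rep_two_one hq hg hs
  have hbij : Function.Bijective fun i => Quotient.mk S (rep hg i) := by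
    constructor
    · intro i j hij
      have h1 : S (rep hg i) (rep hg j) := Quotient.exact hij
      have h2 : S (rep hg j) (rep hg i) := S.symm' h1
      fin_cases i <;> fin_cases j <;> first | rfl | exact absurd h1 ‹_› | exact absurd h2 ‹_›
    · intro a
      induction a using Quotient.inductionOn with | _ H
      obtain ⟨i, hi⟩ := exists_rel_rep hq hqp hg H
      exact ⟨i, Quotient.sound hi⟩
  rw [numAutOrbits, ← Nat.card_eq_of_bijective _ hbij, Nat.card_fin]

theorem numAutOrbits_model_of_mem (hq : q.Prime) (hqp : q < p)
    (hg : orderOf (g.1 / g.2) = q) (hs : g.swap ∈ Subgroup.zpowers g) :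
    numAutOrbits (Model g) (p * q) = 2 := by
  let S := autOrbitSetoid (Model g) (p * q)
  have h01 := not_rel_rep_zero_one hq hg
  have h02 : S (rep hg 0) (rep hg 2) := ⟨swapAut hs, map_swapAut_std hs _⟩
  -- `castSucc` keeps the first axis and the diagonal; the second axis joins the first through
  -- `h02`.
  have hbij : Function.Bijective fun i : Fin 2 => Quotient.mk S (rep hg i.castSucc) := by
    constructor
    · intro i j hij
      have h1 : S (rep hg i.castSucc) (rep hg j.castSucc) := Quotient.exact hij
      have h2 : S (rep hg j.castSucc) (rep hg i.castSucc) := S.symm' h1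
      fin_cases i <;> fin_cases j <;> first | rfl | exact absurd h1 ‹_› | exact absurd h2 ‹_›
    · intro a
      induction a using Quotient.inductionOn with | _ H
      obtain ⟨i, hi⟩ := exists_rel_rep hq hqp hg H
      fin_cases i
      · exact ⟨0, Quotient.sound hi⟩
      · exact ⟨1, Quotient.sound hi⟩
      · exact ⟨0, Quotient.sound (S.trans' h02 hi)⟩
  rw [numAutOrbits, ← Nat.card_eq_of_bijective _ hbij, Nat.card_fin]

end DiagModel

/-! ### Embedding the model in `Hol(N)`. -/

namespace Metacyclic

open DiagModel

variable {p : ℕ} {k : (ZMod p)ˣ}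

theorem N_ext {n m : N k} (h1 : n.left.toAdd = m.left.toAdd) (h2 : n.right = m.right) : n = m :=
  SemidirectProduct.ext (Multiplicative.toAdd.injective h1) h2

theorem toAdd_left_mul (n m : N k) : (n * m).left.toAdd =
    n.left.toAdd + ((n.right : (ZMod p)ˣ) : ZMod p) * m.left.toAdd := rfl

/-- The translation `x ↦ x + v` of `C_p` as an element of `N`. -/
def nTrans (k : (ZMod p)ˣ) (v : ZMod p) : N k := SemidirectProduct.inl (Multiplicative.ofAdd v)

theorem nTrans_add (v w : ZMod p) : nTrans k (v + w) = nTrans k v * nTrans k w := by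
  rw [nTrans, ofAdd_add, map_mul]; rfl

theorem toAdd_left_conj (v : ZMod p) (n : N k) : (MulAut.conj (nTrans k v) n).left.toAdd =
    v + n.left.toAdd - ((n.right : (ZMod p)ˣ) : ZMod p) * v := by
  rw [MulAut.conj_apply, nTrans, ← map_inv, toAdd_left_mul, toAdd_left_mul]
  simp [sub_eq_add_neg]

theorem right_conj (v : ZMod p) (n : N k) :
    (MulAut.conj (nTrans k v) n).right = n.right := by
  simp [MulAut.conj_apply, nTrans]

theorem toAdd_left_scaleAut (b : (ZMod p)ˣ) (n : N k) :
    (scaleAut k b n).left.toAdd = b * n.left.toAdd := rfl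

theorem right_scaleAut (b : (ZMod p)ˣ) (n : N k) : (scaleAut k b n).right = n.right := rfl

theorem scaleAut_mul (b c : (ZMod p)ˣ) : scaleAut k (b * c) = scaleAut k b * scaleAut k c := by
  refine MulEquiv.ext fun n => N_ext ?_ rfl
  rw [MulAut.mul_apply, toAdd_left_scaleAut, toAdd_left_scaleAut, toAdd_left_scaleAut,
    Units.val_mul, mul_assoc]

theorem scaleAut_one : scaleAut k 1 = 1 := by
  refine MulEquiv.ext fun n => N_ext ?_ rfl
  rw [toAdd_left_scaleAut, Units.val_one, one_mul]; rfl

theorem scale_pow (b : (ZMod p)ˣ) (n : ℕ) : scale k b ^ n = scale k (b ^ n) := by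
  rw [scale, ← map_pow, scale]
  congr 1
  induction n with
  | zero => rw [pow_zero, pow_zero, scaleAut_one]
  | succ n ih => rw [pow_succ, pow_succ, scaleAut_mul, ih]

/-- `θ` is conjugation by `σ` to the power `1 / (1 - k)`, so `θ ^ (k - 1)` is conjugation by `σ⁻¹`.
-/
theorem e₂_eq [Fact p.Prime] (hk : k ≠ 1) :
    e₂ k = ⟨nTrans k 1, MulAut.conj (nTrans k (-1))⟩ := by
  have h : 1 - (k : ZMod p) ≠ 0 := by
    rw [sub_ne_zero]; exact fun h => hk (Units.ext h.symm)
  refine SemidirectProduct.ext rfl ?_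
  change θ k ^ _ = _
  rw [θ, ← map_pow, ← map_pow, ← ofAdd_nsmul, nsmul_eq_mul, ZMod.natCast_zmod_val, nTrans]
  congr 3
  field_simp
  ring

/-- The embedding of the translations of the plane in `Hol(N)`, with `(1, 0) ↦ e₁` and
`(0, 1) ↦ e₂`. -/
def planeHom (k : (ZMod p)ˣ) : Multiplicative (ZMod p × ZMod p) →* Hol (N k) where
  toFun v := ⟨nTrans k (v.toAdd.1 + v.toAdd.2), MulAut.conj (nTrans k (-v.toAdd.2))⟩
  map_one' := by
    refine SemidirectProduct.ext ?_ ?_ <;> simp [nTrans]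
  map_mul' v w := by
    refine SemidirectProduct.ext ?_ ?_
    · refine N_ext ?_ ?_
      · change _ = (nTrans k _ * MulAut.conj (nTrans k _) (nTrans k _)).left.toAdd
        rw [toAdd_left_mul, toAdd_left_conj]
        simp [nTrans]
        ring
      · change _ = (nTrans k _ * MulAut.conj (nTrans k _) (nTrans k _)).right
        rw [SemidirectProduct.mul_right, right_conj]
        exact (one_mul 1).symm
    · change _ = MulAut.conj _ * MulAut.conj _
      rw [← map_mul, ← nTrans_add, toAdd_mul, Prod.snd_add, neg_add]

variable {g : (ZMod p)ˣ × (ZMod p)ˣ}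

theorem ratio_mem_zpowers (hg : g.1 / g.2 = k) (l : Subgroup.zpowers g) :
    (l : (ZMod p)ˣ × (ZMod p)ˣ).1 / (l : (ZMod p)ˣ × (ZMod p)ˣ).2 ∈ Subgroup.zpowers k := by
  obtain ⟨l, n, rfl⟩ := l
  exact ⟨n, by change k ^ n = g.1 ^ n / g.2 ^ n; rw [← hg, div_zpow]⟩

/-- The embedding of the diagonal matrices `diag(z * b, b)` with `z ∈ ⟨k⟩` in `Hol(N)`. -/
def diagHom (hg : g.1 / g.2 = k) : Subgroup.zpowers g →* Hol (N k) where
  toFun l := ⟨SemidirectProduct.inr ⟨_, ratio_mem_zpowers hg l⟩,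
    scaleAut k (l : (ZMod p)ˣ × (ZMod p)ˣ).2⟩
  map_one' := by
    refine SemidirectProduct.ext (N_ext rfl (Subtype.ext ?_)) scaleAut_one
    simp
  map_mul' l l' := by
    refine SemidirectProduct.ext (N_ext ?_ (Subtype.ext ?_)) (scaleAut_mul _ _)
    · change (0 : ZMod p) = 0 + ((_ : (ZMod p)ˣ) : ZMod p) * (_ * 0)
      rw [mul_zero, mul_zero, add_zero]
    · simp [right_scaleAut, mul_div_mul_comm]

/-- The embedding of the model group in `Hol(N)`. -/
def modelHom (hg : g.1 / g.2 = k) : Model g →* Hol (N k) :=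
  SemidirectProduct.lift (planeHom k) (diagHom hg) fun l => by
    refine MonoidHom.ext fun v => ?_
    change planeHom k (diagAction p l v) = diagHom hg l * planeHom k v * (diagHom hg l)⁻¹
    rw [eq_mul_inv_iff_mul_eq]
    refine SemidirectProduct.ext (N_ext ?_ ?_) (MulEquiv.ext fun n => N_ext ?_ ?_)
    · change (nTrans k _ * MulAut.conj (nTrans k _) (SemidirectProduct.inr _)).left.toAdd =
        (SemidirectProduct.inr _ * scaleAut k _ (nTrans k _)).left.toAdd
      rw [toAdd_left_mul, toAdd_left_mul, toAdd_left_conj, toAdd_left_scaleAut]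
      simp only [nTrans, SemidirectProduct.left_inl, SemidirectProduct.right_inl,
        SemidirectProduct.left_inr, SemidirectProduct.right_inr, toAdd_ofAdd, toAdd_one,
        diagAction_apply, OneMemClass.coe_one, Units.val_one]
      have h : ((l : (ZMod p)ˣ × (ZMod p)ˣ).1 : ZMod p) =
        ((l : (ZMod p)ˣ × (ZMod p)ˣ).1 / (l : (ZMod p)ˣ × (ZMod p)ˣ).2 : (ZMod p)ˣ) *
          (l : (ZMod p)ˣ × (ZMod p)ˣ).2 := by
        rw [← Units.val_mul, div_mul_cancel]
      rw [h]
      ring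
    · change (nTrans k _ * MulAut.conj (nTrans k _) (SemidirectProduct.inr _)).right =
        (SemidirectProduct.inr _ * scaleAut k _ (nTrans k _)).right
      rw [SemidirectProduct.mul_right, SemidirectProduct.mul_right, right_conj, right_scaleAut]
      exact (one_mul _).trans (mul_one _).symm
    · change (MulAut.conj (nTrans k _) (scaleAut k _ n)).left.toAdd =
        (scaleAut k _ (MulAut.conj (nTrans k _) n)).left.toAdd
      rw [toAdd_left_conj, toAdd_left_scaleAut, toAdd_left_scaleAut, toAdd_left_conj,
        right_scaleAut, diagAction_apply, toAdd_ofAdd]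
      ring
    · change (MulAut.conj (nTrans k _) (scaleAut k _ n)).right =
        (scaleAut k _ (MulAut.conj (nTrans k _) n)).right
      rw [right_conj, right_scaleAut, right_scaleAut, right_conj]

theorem modelHom_shift (hg : g.1 / g.2 = k) (v : ZMod p × ZMod p) :
    modelHom hg (shift v) = planeHom k (Multiplicative.ofAdd v) :=
  SemidirectProduct.lift_inl _ _ _ _

theorem modelHom_ofLin (hg : g.1 / g.2 = k) (l : Subgroup.zpowers g) :
    modelHom hg (ofLin l) = diagHom hg l :=
  SemidirectProduct.lift_inr _ _ _ _

theorem model_eq_shift_mul_ofLin (h : Model g) : h = shift (vec h) * ofLin h.right :=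
  (SemidirectProduct.inl_left_mul_inr_right h).symm

variable [Fact p.Prime]

theorem modelHom_injective (hg : g.1 / g.2 = k) (hk : k ≠ 1) :
    Function.Injective (modelHom hg) := by
  rw [injective_iff_map_eq_one]
  intro h hh
  rw [model_eq_shift_mul_ofLin h, map_mul, modelHom_shift, modelHom_ofLin] at hh
  obtain ⟨⟨x, y⟩, hv⟩ : ∃ v, v = vec h := ⟨_, rfl⟩
  rw [← hv] at hh
  have h1 : nTrans k (x + y) * MulAut.conj (nTrans k (-y)) (SemidirectProduct.inr
    ⟨_, ratio_mem_zpowers hg h.right⟩) = 1 := congrArg SemidirectProduct.left hh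
  have h2 : MulAut.conj (nTrans k (-y)) * scaleAut k (lin h).2 = 1 :=
    congrArg SemidirectProduct.right hh
  have hr := congrArg SemidirectProduct.right h1
  rw [SemidirectProduct.mul_right, right_conj] at hr
  have hr' : (lin h).1 / (lin h).2 = 1 := by
    have := congrArg Subtype.val hr
    simpa [nTrans, lin] using this
  -- The automorphism component is trivial: its value at `σ` gives scale factor `1`, its value at
  -- `τ` gives `(1 - k) y = 0`.
  have hσ := congrArg (fun n : N k => n.left.toAdd) (DFunLike.congr_fun h2 (σ k))
  have hτ := congrArg (fun n : N k => n.left.toAdd) (DFunLike.congr_fun h2 (τ k))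
  have hl := congrArg (fun n : N k => n.left.toAdd) h1
  simp only [MulAut.mul_apply, MulAut.one_apply, toAdd_left_conj, toAdd_left_scaleAut,
    right_scaleAut, toAdd_left_mul] at hσ hτ hl
  simp only [σ, τ, nTrans, SemidirectProduct.left_inl, SemidirectProduct.right_inl,
    SemidirectProduct.left_inr, SemidirectProduct.right_inr, toAdd_ofAdd, toAdd_one,
    OneMemClass.coe_one, Units.val_one, SemidirectProduct.one_left] at hσ hτ hl
  have hb : (lin h).2 = 1 := Units.ext (by simpa using hσ)
  rw [hb, div_one] at hr'
  have hy : y = 0 := by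
    have h3 : (1 - (k : ZMod p)) * y = 0 := by linear_combination -hτ
    refine (mul_eq_zero.1 h3).resolve_left ?_
    exact sub_ne_zero.2 fun h => hk (Units.ext h.symm)
  have hx : x = 0 := by simpa [hy] using hl
  exact model_ext (by rw [← hv, hx, hy]; rfl) (Prod.ext hr' hb)

/-- `hx` and `hy` put the linear parts of `T A ^ m` and `B ^ l` into `⟨g⟩`, so that the two
generators may be replaced by their product. -/
theorem range_modelHom (hk : k ≠ 1) {aα aβ : (ZMod p)ˣ} {m l : ℕ}
    (hg : (k * aα ^ m * aβ ^ l, aα ^ m * aβ ^ l) = g)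
    (hx : (k * aα ^ m, aα ^ m) ∈ Subgroup.zpowers g)
    (hy : (aβ ^ l, aβ ^ l) ∈ Subgroup.zpowers g) (hgk : g.1 / g.2 = k) :
    (modelHom hgk).range = transitiveSubgroup k aα aβ m l := by
  have h1 : modelHom hgk (shift (1, 0)) = e₁ k := by
    rw [modelHom_shift]
    refine SemidirectProduct.ext ?_ ?_
    · change nTrans k (1 + 0) = σ k
      rw [add_zero]; rfl
    · change MulAut.conj (nTrans k (-0)) = 1
      rw [neg_zero, nTrans, ofAdd_zero, map_one, map_one]
  have h2 : modelHom hgk (shift (0, 1)) = e₂ k := by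
    rw [modelHom_shift, e₂_eq hk]
    refine SemidirectProduct.ext ?_ rfl
    change nTrans k (0 + 1) = _
    rw [zero_add]
  have h3 : modelHom hgk (ofLin ⟨_, hx⟩) = T k * scale k aα ^ m := by
    rw [modelHom_ofLin, scale_pow]
    refine SemidirectProduct.ext (N_ext ?_ (Subtype.ext ?_)) ?_
    · simp [diagHom, T, scale, τ]
    · simp [diagHom, T, scale, τ]
    · simp [diagHom, T, scale]
  have h4 : modelHom hgk (ofLin ⟨_, hy⟩) = scale k aβ ^ l := by
    rw [modelHom_ofLin, scale_pow]
    refine SemidirectProduct.ext (N_ext ?_ (Subtype.ext ?_)) ?_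
    · simp [diagHom, scale]
    · simp [diagHom, scale]
    · simp [diagHom, scale]
  apply le_antisymm
  · have he₁ : e₁ k ∈ transitiveSubgroup k aα aβ m l :=
      Subgroup.mem_sup_left (Subgroup.subset_closure (by simp))
    have he₂ : e₂ k ∈ transitiveSubgroup k aα aβ m l :=
      Subgroup.mem_sup_left (Subgroup.subset_closure (by simp))
    have hX : T k * scale k aα ^ m ∈ transitiveSubgroup k aα aβ m l :=
      Subgroup.mem_sup_right (Subgroup.subset_closure (by simp))
    have hY : scale k aβ ^ l ∈ transitiveSubgroup k aα aβ m l :=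
      Subgroup.mem_sup_right (Subgroup.subset_closure (by simp))
    rintro _ ⟨h, rfl⟩
    rw [model_eq_shift_mul_ofLin h, map_mul]
    refine Subgroup.mul_mem _ ?_ ?_
    · have : (shift (vec h) : Model g) =
          shift (1, 0) ^ (vec h).1.val * shift (0, 1) ^ (vec h).2.val := by
        refine model_ext ?_ ?_
        · rw [vec_mul, vec_pow rfl, vec_pow rfl, lin_pow]
          simp
        · simp [lin_pow]
      rw [this, map_mul, map_pow, map_pow, h1, h2]
      exact Subgroup.mul_mem _ (Subgroup.pow_mem _ he₁ _) (Subgroup.pow_mem _ he₂ _)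
    · obtain ⟨n, hn⟩ := h.right.2
      have : h.right = (⟨_, hx⟩ * ⟨_, hy⟩) ^ n := by
        refine Subtype.ext (hn.symm.trans ?_)
        change g ^ n = ((k * aα ^ m, aα ^ m) * (aβ ^ l, aβ ^ l)) ^ n
        rw [Prod.mk_mul_mk, hg]
      rw [this, ofLin, map_zpow, map_mul, map_zpow, map_mul]
      change (modelHom hgk (ofLin _) * modelHom hgk (ofLin _)) ^ n ∈ _
      rw [h3, h4]
      exact Subgroup.zpow_mem _ (Subgroup.mul_mem _ hX hY) n
  · refine sup_le ((Subgroup.closure_le _).2 ?_) ((Subgroup.closure_le _).2 ?_)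
    · rintro _ (rfl | rfl)
      exacts [⟨_, h1⟩, ⟨_, h2⟩]
    · rintro _ (rfl | rfl)
      exacts [⟨_, h3⟩, ⟨_, h4⟩]

end Metacyclic

/-! ### Arithmetic of the cyclic complement. -/

theorem mem_zpowers_mul_of_coprime {G : Type*} [CommGroup G] {x y : G} {m n : ℕ}
    -- The Bézout exponent used below is `1` modulo `m` and `0` modulo `n`.
    (hx : x ^ m = 1) (hy : y ^ n = 1) (h : m.Coprime n) : x ∈ Subgroup.zpowers (x * y) := by
  refine ⟨n * m.gcdB n, ?_⟩
  have h1 : (1 : ℤ) = m * m.gcdA n + n * m.gcdB n := by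
    rw [← Nat.gcd_eq_gcd_ab, h.gcd_eq_one, Nat.cast_one]
  have h2 : x = x ^ ((m : ℤ) * m.gcdA n + n * m.gcdB n) := by rw [← h1, zpow_one]
  have h3 : x ^ ((n : ℤ) * m.gcdB n) = x := by
    rw [zpow_add, zpow_mul, zpow_natCast, hx, one_zpow, one_mul] at h2
    exact h2.symm
  change (x * y) ^ ((n : ℤ) * m.gcdB n) = x
  rw [mul_zpow, h3, zpow_mul y, zpow_natCast, hy, one_zpow, mul_one]

theorem orderOf_pow_unit_mul {G : Type*} [Group G] {a : G} {q c e v : ℕ} (hq : q.Prime)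
    (ha : orderOf a = q ^ e) (hce : c ≤ e) (hv : v.Coprime q) :
    orderOf (a ^ (v * q ^ (e - c))) = q ^ c := by
  have h1 : q ^ (e - c) ∣ orderOf a := by rw [ha]; exact pow_dvd_pow _ (Nat.sub_le _ _)
  have hpos : 0 < q ^ (e - c) := pow_pos hq.pos _
  have h2 : orderOf (a ^ q ^ (e - c)) = q ^ c := by
    rw [orderOf_pow_of_dvd hpos.ne' h1, ha, Nat.pow_div (Nat.sub_le _ _) hq.pos]
    congr 1
    omega
  rw [mul_comm, pow_mul, Nat.Coprime.orderOf_pow, h2]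
  rw [h2]
  exact (hv.pow_right c).symm

theorem coprime_div_pow_padicValNat {q n : ℕ} (hq : q.Prime) (hn : n ≠ 0) :
    q.Coprime (n / q ^ padicValNat q n) := by
  have : Fact q.Prime := ⟨hq⟩
  rw [hq.coprime_iff_not_dvd]
  intro h
  apply pow_succ_padicValNat_not_dvd (p := q) hn
  rw [pow_succ]
  exact Nat.mul_dvd_of_dvd_div pow_padicValNat_dvd h

/-- Arithmetic consequences of stability of `⟨(k a b, a b)⟩` under exchanging coordinates. -/
theorem eq_one_and_of_swap_mem {G : Type*} [CommGroup G] {k a b : G} {q c d : ℕ} (hq : q.Prime)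
    (hq2 : Odd q) (hk : orderOf k = q) (ha : orderOf a = q ^ c) (hb : b ^ d = 1)
    (hc : 1 ≤ c) (hqd : q.Coprime d)
    (h : (k * a * b, a * b).swap ∈ Subgroup.zpowers (k * a * b, a * b)) :
    c = 1 ∧ ∀ v : ℕ, a = k ^ v → q ∣ 2 * v + 1 := by
  obtain ⟨r, hr⟩ := h
  have h1 : (k * a * b) ^ r = a * b := congrArg Prod.fst hr
  have h2 : (a * b) ^ r = k * a * b := congrArg Prod.snd hr
  -- Dividing the two coordinates of the swap relation: raising to the power `r` inverts `k`.
  have h3 : k ^ (r + 1) = 1 := by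
    have : k ^ r * (k * a * b) = a * b := by rw [← h2, ← mul_zpow, ← mul_assoc, h1]
    rw [zpow_add, zpow_one]
    rw [mul_assoc, ← mul_assoc, mul_eq_right] at this
    exact this
  have h4 : (q : ℤ) ∣ r + 1 := by rw [← hk]; exact orderOf_dvd_iff_zpow_eq_one.2 h3
  have h5 : (a * b) ^ (r - 1) = k := by
    rw [zpow_sub, zpow_one, h2, mul_assoc k, mul_inv_cancel_right]
  -- The power `d` removes `b` and loses nothing at `q`.
  have h6 : a ^ ((r - 1) * d) = k ^ d := by
    rw [← h5, ← zpow_natCast, ← zpow_mul, mul_zpow, mul_comm (r - 1), zpow_mul b, zpow_natCast b,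
      hb, one_zpow, mul_one]
  -- Since `r ≡ -1`, the exponent `r - 1` is `-2` modulo the odd prime `q`.
  have hqr : ¬ (q : ℤ) ∣ r - 1 := by
    intro h7
    have h8 : (q : ℤ) ∣ 2 := by
      have := dvd_sub h4 h7
      ring_nf at this
      exact this
    have h9 : q ∣ 2 := by exact_mod_cast h8
    have h10 := (Nat.prime_dvd_prime_iff_eq hq Nat.prime_two).1 h9
    subst h10
    exact absurd hq2 (by decide)
  have hqI : Prime (q : ℤ) := Nat.prime_iff_prime_int.1 hq
  have hqd' : ¬ (q : ℤ) ∣ d := by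
    rw [Int.natCast_dvd_natCast]; exact (hq.coprime_iff_not_dvd).1 hqd
  have hqrd : ¬ (q : ℤ) ∣ (r - 1) * d := fun h => (hqI.dvd_or_dvd h).elim hqr hqd'
  -- The right side of `h6` is killed by `q`, and the exponent of `a` is prime to `q`, so `a` itself
  -- is killed by `q`.
  have hc1 : c = 1 := by
    by_contra hne
    have hc2 : 2 ≤ c := by omega
    have h7 : a ^ ((r - 1) * d * q) = 1 := by
      rw [zpow_mul, h6, zpow_natCast, ← pow_mul, mul_comm, pow_mul, ← hk, pow_orderOf_eq_one,
        one_pow]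
    have h8 := orderOf_dvd_iff_zpow_eq_one.2 h7
    rw [ha] at h8
    have h9 : ((q : ℤ) * q) ∣ (r - 1) * d * q := by
      refine dvd_trans ?_ h8
      rw [← sq, Nat.cast_pow]
      exact pow_dvd_pow _ hc2
    exact hqrd (Int.dvd_of_mul_dvd_mul_right hqI.ne_zero h9)
  refine ⟨hc1, fun v hv => ?_⟩
  have h7 : k ^ ((v : ℤ) * ((r - 1) * d) - d) = 1 := by
    rw [zpow_sub, zpow_mul, zpow_natCast, zpow_natCast, ← hv, h6, mul_inv_cancel]
  have h8 : (q : ℤ) ∣ (v * (r - 1) - 1) * d := by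
    have := orderOf_dvd_iff_zpow_eq_one.2 h7
    rw [hk] at this
    convert this using 1
    ring
  have h9 := (hqI.dvd_or_dvd h8).resolve_right hqd'
  -- `v (r - 1) ≡ 1` and `r ≡ -1` combine to `2 v + 1 ≡ 0`.
  have h10 : (q : ℤ) ∣ v * (r + 1) - (v * (r - 1) - 1) := dvd_sub (h4.mul_left _) h9
  have h11 : (v : ℤ) * (r + 1) - (v * (r - 1) - 1) = ((2 * v + 1 : ℕ) : ℤ) := by push_cast; ring
  rw [h11] at h10
  exact_mod_cast h10

/-! ### Assembly. -/

theorem mainTheorem12 (p q : ℕ) (hp : p.Prime) (hq : q.Prime) (hq_odd : Odd q) (hqp : q < p)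
    (hq_dvd : q ∣ p - 1)
    (e₀ s : ℕ) (he₀ : e₀ = padicValNat q (p - 1)) (hs : s = (p - 1) / q ^ e₀)
    (k aα aβ : (ZMod p)ˣ) (hk : orderOf k = q) (haα : orderOf aα = q ^ e₀)
    (haβ : orderOf aβ = s) (hkα : aα ^ q ^ (e₀ - 1) = k)
    (c d : ℕ) (hc : 1 ≤ c) (hce : c ≤ e₀) (hd : d ∣ s) (u : (ZMod (q ^ c))ˣ)
    (G : Subgroup (Hol (Metacyclic.N k)))
    (hG : G = Metacyclic.transitiveSubgroup k aα aβ
      ((u : ZMod (q ^ c)).val * q ^ (e₀ - c)) (s / d)) :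
    numIsoClasses G (p * q) = 1 ∧
    ((c = 1 ∧ (u : ZMod (q ^ c)) = (((q - 1) / 2 : ℕ) : ZMod (q ^ c))) →
      numAutOrbits G (p * q) = 2) ∧
    (¬ (c = 1 ∧ (u : ZMod (q ^ c)) = (((q - 1) / 2 : ℕ) : ZMod (q ^ c))) →
      numAutOrbits G (p * q) = 3) := by
  have : Fact p.Prime := ⟨hp⟩
  have : NeZero (q ^ c) := ⟨pow_ne_zero _ hq.ne_zero⟩
  have hk1 : k ≠ 1 := by
    rintro rfl
    rw [orderOf_one] at hk
    exact hq.one_lt.ne hk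
  have hv : (u : ZMod (q ^ c)).val.Coprime q :=
    (Nat.coprime_pow_right_iff hc _ _).1 (ZMod.val_coe_unit_coprime u)
  have hvlt : (u : ZMod (q ^ c)).val < q ^ c := ZMod.val_lt _
  have hu : ∀ n : ℕ, n < q ^ c → ((u : ZMod (q ^ c)) = n ↔ (u : ZMod (q ^ c)).val = n) := by
    intro n hn
    constructor
    · intro h; rw [h, ZMod.val_cast_of_lt hn]
    · intro h; rw [← h, ZMod.natCast_zmod_val]
  generalize (u : ZMod (q ^ c)).val = v at hv hvlt hu hG
  generalize (u : ZMod (q ^ c)) = u' at hu ⊢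
  have ha := orderOf_pow_unit_mul hq haα hce hv
  have haα1 : c = 1 → aα ^ (v * q ^ (e₀ - c)) = k ^ v := by
    rintro rfl
    rw [mul_comm, pow_mul, hkα]
  have hb : (aβ ^ (s / d)) ^ d = 1 := by
    rw [← pow_mul, Nat.div_mul_cancel hd, ← haβ, pow_orderOf_eq_one]
  have hqd : q.Coprime d := by
    refine Nat.Coprime.coprime_dvd_right hd ?_
    rw [hs, he₀]
    exact coprime_div_pow_padicValNat hq (Nat.sub_ne_zero_of_lt hp.one_lt)
  have hkq : k ^ q ^ c = 1 := by
    rw [← orderOf_dvd_iff_pow_eq_one, hk]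
    exact dvd_pow_self q (by omega)
  obtain ⟨x, hx⟩ : ∃ x, x = (k * aα ^ (v * q ^ (e₀ - c)), aα ^ (v * q ^ (e₀ - c))) := ⟨_, rfl⟩
  obtain ⟨y, hy⟩ : ∃ y, y = (aβ ^ (s / d), aβ ^ (s / d)) := ⟨_, rfl⟩
  have hxq : x ^ q ^ c = 1 := by
    rw [hx, Prod.pow_mk, mul_pow, hkq, one_mul, ← ha, pow_orderOf_eq_one]
    rfl
  have hyd : y ^ d = 1 := by
    rw [hy, Prod.pow_mk, hb]
    rfl
  have hxg : x ∈ Subgroup.zpowers (x * y) :=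
    mem_zpowers_mul_of_coprime hxq hyd (hqd.pow_left c)
  have hyg : y ∈ Subgroup.zpowers (x * y) := by
    rw [mul_comm x y]
    exact mem_zpowers_mul_of_coprime hyd hxq (hqd.pow_left c).symm
  have hxy : (k * aα ^ (v * q ^ (e₀ - c)) * aβ ^ (s / d),
      aα ^ (v * q ^ (e₀ - c)) * aβ ^ (s / d)) = x * y := by rw [hx, hy]; rfl
  have hgk : (x * y).1 / (x * y).2 = k := by
    rw [hx, hy]
    change k * _ * _ / (_ * _) = k
    rw [mul_assoc, mul_div_cancel_right]
  have hg : orderOf ((x * y).1 / (x * y).2) = q := by rw [hgk, hk]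
  have hrange := Metacyclic.range_modelHom hk1 hxy (hx ▸ hxg) (hy ▸ hyg) hgk
  let e : DiagModel.Model (x * y) ≃* G :=
    (MonoidHom.ofInjective (Metacyclic.modelHom_injective hgk hk1)).trans
      (MulEquiv.subgroupCongr (hrange.trans hG.symm))
  obtain ⟨w, hw⟩ := hq_odd
  have hw2 : (q - 1) / 2 = w := by omega
  rw [hw2]
  -- `(q - 1) / 2` is a reduced residue, so the congruence for `u` becomes an equality of natural
  -- numbers.
  have hwq : w < q ^ c := lt_of_lt_of_le (by omega) (Nat.le_self_pow (by omega) q)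
  rw [hu w hwq, ← numAutOrbits_congr e, ← numIsoClasses_congr e]
  refine ⟨DiagModel.numIsoClasses_model hq hqp hg, ?_, ?_⟩
  · rintro ⟨rfl, rfl⟩
    refine DiagModel.numAutOrbits_model_of_mem hq hqp hg ?_
    -- With `2 v + 1 = q` the entries `k ^ (v + 1)` and `k ^ v` of `x` are mutually inverse, so
    -- swapping inverts `x` and fixes the scalar `y`.
    have h1 : (x * y).swap = x⁻¹ * y := by
      rw [hx, hy, haα1 rfl]
      have h2 : k ^ v * (k * k ^ v) = 1 := by
        rw [← pow_succ', ← pow_add, ← orderOf_dvd_iff_pow_eq_one, hk, hw]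
        exact ⟨1, by ring⟩
      refine Prod.ext ?_ ?_
      · change k ^ v * _ = (k * k ^ v)⁻¹ * _
        exact congrArg₂ _ (eq_inv_of_mul_eq_one_left h2) rfl
      · change k * k ^ v * _ = (k ^ v)⁻¹ * _
        exact congrArg₂ _ (eq_inv_of_mul_eq_one_right h2) rfl
    rw [h1]
    exact Subgroup.mul_mem _ (Subgroup.inv_mem _ hxg) hyg
  · intro hn
    refine DiagModel.numAutOrbits_model_of_not_mem hq hqp hg fun hmem => hn ?_
    rw [← hxy] at hmem
    obtain ⟨hc1, h1⟩ := eq_one_and_of_swap_mem hq ⟨w, hw⟩ hk ha hb hc hqd hmem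
    refine ⟨hc1, ?_⟩
    obtain ⟨t, ht⟩ := h1 v (haα1 hc1)
    rw [hc1, pow_one] at hvlt
    -- `2 v + 1 = q t` with `v < q` leaves only `t = 1`, that is `v = (q - 1) / 2`.
    have ht0 : t ≠ 0 := by rintro rfl; omega
    have ht2 : t < 2 := by
      by_contra h
      have := Nat.mul_le_mul_left q (not_lt.1 h)
      omega
    have : t = 1 := by omega
    subst this
    omega
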